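/- Let $(M,\operatorname{dist},\mu)$ be a metric probability space. For $n\ge 1$ and $r\ge 0$ let $G_M(n,r)$ be the random graph on $[n]=\{1,\dots,n\}$ obtained by sampling $x_1,\dots,x_n\in M$ independently from $\mu$ and joining distinct $i,j$ when $\operatorname{dist}(x_i,x_j)\le r$. A monotone graph property on $[n]$ is a family of graphs on the labelled vertex set $[n]$ closed under adding edges (not necessarily invariant under relabelling of the vertices); it is nontrivial if it is neither empty nor the family of all graphs on $[n]$. A sequence of positive real numbers $(r_n)$ is a threshold for a sequence $(\mathcal F_n)_{n\ge 2}$ of nontrivial monotone graph properties, $\mathcal F_n$ on $[n]$, if for every sequence of radii $s_n\ge 0$, \[ \mathbb P\bigl(G_M(n,s_n)\in\mathcal F_n\bigr)\to 0\ \text{ whenever } s_n/r_n\to 0, \qquad \mathbb P\bigl(G_M(n,s_n)\in\mathcal F_n\bigr)\to 1\ \text{ whenever } s_n/r_n\to\infty . \] The space $M$ admits thresholds if every sequence $(\mathcal F_n)_{n\ge 2}$ of nontrivial monotone graph properties has a threshold. For every integer $d\ge 1$, the cube $[0,1]^d$, with the Euclidean metric and Lebesgue measure, admits thresholds. -/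

import Mathlib

open Filter MeasureTheory Topology

noncomputable section

namespace RandomGeometricGraph

/-- The geometric graph on the vertex set `Fin n` of a configuration `x` at radius `r`:
distinct `i`, `j` are adjacent when `dist (x i) (x j) ≤ r`. -/
def geomGraph {M : Type*} [MetricSpace M] {n : ℕ} (x : Fin n → M) (r : ℝ) :
    SimpleGraph (Fin n) where
  Adj i j := i ≠ j ∧ dist (x i) (x j) ≤ r
  symm := ⟨fun _ _ h => ⟨h.1.symm, by rw [dist_comm]; exact h.2⟩⟩
  loopless := ⟨fun _ h => h.1 rfl⟩

/-- The probability that the random geometric graph on `n` independent points of law `μ`,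
at radius `r`, belongs to the family `F`. -/
def prob {M : Type*} [MetricSpace M] [MeasurableSpace M] (μ : Measure M) {n : ℕ}
    (F : Set (SimpleGraph (Fin n))) (r : ℝ) : ℝ :=
  (Measure.pi fun _ : Fin n => μ).real {x : Fin n → M | geomGraph x r ∈ F}

/-- A nontrivial monotone property of labelled graphs on `Fin n`: closed under adding edges,
neither empty nor the family of all graphs. -/
structure IsNontrivialMonotone {n : ℕ} (F : Set (SimpleGraph (Fin n))) : Prop where
  monotone : ∀ G ∈ F, ∀ H : SimpleGraph (Fin n), G ≤ H → H ∈ F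
  ne_empty : F ≠ ∅
  ne_univ : F ≠ Set.univ

/-- The sequence of (positive) radii `r` is a threshold for the sequence of properties `F`. -/
def IsThreshold {M : Type*} [MetricSpace M] [MeasurableSpace M] (μ : Measure M)
    (F : ∀ n : ℕ, Set (SimpleGraph (Fin n))) (r : ℕ → ℝ) : Prop :=
  (∀ n, 0 < r n) ∧
    ∀ s : ℕ → ℝ, (∀ n, 0 ≤ s n) →
      (Tendsto (fun n => s n / r n) atTop (𝓝 0) →
        Tendsto (fun n => prob μ (F n) (s n)) atTop (𝓝 0)) ∧
      (Tendsto (fun n => s n / r n) atTop atTop →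
        Tendsto (fun n => prob μ (F n) (s n)) atTop (𝓝 1))

/-- The metric probability space `(M, dist, μ)` admits thresholds: every sequence of nontrivial
monotone properties has a threshold.  There is only one graph on at most one vertex, hence no
nontrivial property, so the hypothesis is made for `n ≥ 2` (else it could never hold). -/
def AdmitsThresholds (M : Type*) [MetricSpace M] [MeasurableSpace M] [BorelSpace M]
    (μ : Measure M) [IsProbabilityMeasure μ] : Prop :=
  ∀ F : ∀ n : ℕ, Set (SimpleGraph (Fin n)),
    (∀ n, 2 ≤ n → IsNontrivialMonotone (F n)) → ∃ r : ℕ → ℝ, IsThreshold μ F r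

/-- The cube `[0,1]^d` as a subset of Euclidean space.  As a subtype it carries the Euclidean
metric. -/
def cube (d : ℕ) : Set (EuclideanSpace ℝ (Fin d)) :=
  {x | ∀ i, x i ∈ Set.Icc (0 : ℝ) 1}

theorem volume_cube (d : ℕ) : volume (cube d) = 1 := by
  have h : cube d = (WithLp.ofLp : EuclideanSpace ℝ (Fin d) → Fin d → ℝ) ⁻¹'
      (Set.univ.pi fun _ => Set.Icc (0 : ℝ) 1) := by
    ext x; simp [cube, Set.mem_pi, -Set.pi_univ_Icc]
  rw [h, (PiLp.volume_preserving_ofLp (Fin d)).measure_preimage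
    (MeasurableSet.univ_pi fun _ => measurableSet_Icc).nullMeasurableSet, volume_pi_pi]
  simp

theorem measurableSet_cube (d : ℕ) : MeasurableSet (cube d) := by
  have h : cube d = ⋂ i, {x : EuclideanSpace ℝ (Fin d) | x i ∈ Set.Icc (0 : ℝ) 1} := by
    ext x; simp [cube]
  rw [h]
  exact MeasurableSet.iInter fun i =>
    (by fun_prop : Measurable fun x : EuclideanSpace ℝ (Fin d) => x i) measurableSet_Icc

/-- Lebesgue measure on the cube. -/
def cubeMeasure (d : ℕ) : Measure (cube d) :=
  Measure.comap Subtype.val (volume : Measure (EuclideanSpace ℝ (Fin d)))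

instance isProbabilityMeasure_cubeMeasure (d : ℕ) : IsProbabilityMeasure (cubeMeasure d) where
  measure_univ := by
    rw [cubeMeasure, comap_subtype_coe_apply (measurableSet_cube d), Set.image_univ,
      Subtype.range_coe, volume_cube]

end RandomGeometricGraph

end

open Filter MeasureTheory Topology

noncomputable section

namespace RandomGeometricGraph

open ComplexConjugate

/-! Doubling the radius at least doubles the odds `p / (1 - p)` of any nontrivial monotone property,
uniformly in the property and in `n`. Choosing `r n` so that the probability is below `1/2` at `r n`
and at least `1/2` at `2 * r n` then gives a threshold.

The doubling (`two_mul_prob_le`) compares the cube with the torus. Wrapping the cube onto the torus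
is 1-Lipschitz, folding the torus onto the cube by `2 * ‖z‖` is 2-Lipschitz, and both preserve
measure. So the torus event `D` at radius `r` is at least as likely as the cube event at `r`, and
lies in the fold preimage `A` of the cube event at `2 * r`. The two sets have different symmetries:
`D` is invariant under adding one constant to all coordinates, `A` under negating any single
coordinate.

Let `q` and `p` be the measures of `D` and `A`. The Fourier coefficients of `D` live on frequencies
of zero sum (`setCoeff_eq_zero`). Negating a nonzero entry of such a frequency destroys the zero sum
but keeps the coefficient of `A`, so at most half of the variance `p (1 - p)` of `A` sits on nonzero
zero-sum frequencies (`two_mul_tsum_balancedWeight_le`). As `D ⊆ A`, the covariance is `q (1 - p)`,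
and Cauchy–Schwarz gives `(q (1 - p))² ≤ q (1 - q) p (1 - p) / 2`, that is `2 q (1 - p) ≤ p (1 -
q)`. -/

/-- The uniform probability measure on the torus `(ℝ/ℤ)^ι`. -/
def torusMeasure (ι : Type*) [Fintype ι] : Measure (UnitAddTorus ι) :=
  Measure.pi fun _ => AddCircle.haarAddCircle

/-! ### Fourier analysis of symmetric sets on the torus -/

section Fourier

variable {ι : Type*} [Fintype ι]

instance : IsProbabilityMeasure (torusMeasure ι) := by
  unfold torusMeasure; infer_instance

instance : (torusMeasure ι).IsAddHaarMeasure := by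
  unfold torusMeasure; infer_instance

/-- The Fourier coefficients of the indicator function of a subset of the torus. -/
def setCoeff (S : Set (UnitAddTorus ι)) (k : ι → ℤ) : ℂ :=
  ∫ z in S, UnitAddTorus.mFourier (-k) z ∂torusMeasure ι

theorem hasSum_setCoeff_mul {S T : Set (UnitAddTorus ι)} (hS : MeasurableSet S)
    (hT : MeasurableSet T) :
    HasSum (fun k => conj (setCoeff S k) * setCoeff T k)
      (((torusMeasure ι).real (S ∩ T) : ℝ) : ℂ) := by
  let f : Lp ℂ 2 (torusMeasure ι) := indicatorConstLp 2 hS (measure_ne_top _ _) 1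
  let g : Lp ℂ 2 (torusMeasure ι) := indicatorConstLp 2 hT (measure_ne_top _ _) 1
  have hf : f =ᵐ[torusMeasure ι] S.indicator fun _ => 1 := indicatorConstLp_coeFn
  have hg : g =ᵐ[torusMeasure ι] T.indicator fun _ => 1 := indicatorConstLp_coeFn
  have coeff {U : Set (UnitAddTorus ι)} (hU : MeasurableSet U) {h : UnitAddTorus ι → ℂ}
      (hh : h =ᵐ[torusMeasure ι] U.indicator fun _ => 1) (k : ι → ℤ) :
      UnitAddTorus.mFourierCoeff h k = setCoeff U k := by
    rw [setCoeff, ← integral_indicator hU]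
    refine integral_congr_ae ?_
    filter_upwards [hh] with z hz
    by_cases hzU : z ∈ U <;> simp [hz, hzU]
  have key := UnitAddTorus.hasSum_prod_mFourierCoeff f g
  have hinner : ∫ t, conj (f t) * g t ∂torusMeasure ι =
      (((torusMeasure ι).real (S ∩ T) : ℝ) : ℂ) := by
    trans ∫ t, (S ∩ T).indicator (fun _ => (1 : ℂ)) t ∂torusMeasure ι
    · refine integral_congr_ae ?_
      filter_upwards [hf, hg] with z h1 h2
      rw [h1, h2]
      by_cases hzS : z ∈ S <;> by_cases hzT : z ∈ T <;> simp [hzS, hzT]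
    · rw [integral_indicator (hS.inter hT)]
      simp
  rw [← hinner]
  convert! key using 3 with k
  · exact congrArg conj (coeff hS hf k).symm
  · exact (coeff hT hg k).symm

theorem hasSum_sq_setCoeff {S : Set (UnitAddTorus ι)} (hS : MeasurableSet S) :
    HasSum (fun k => ‖setCoeff S k‖ ^ 2) ((torusMeasure ι).real S) := by
  have h := Complex.hasSum_re (hasSum_setCoeff_mul hS hS)
  rw [Set.inter_self, Complex.ofReal_re] at h
  convert! h using 2 with k
  rw [Complex.conj_mul', ← Complex.ofReal_pow, Complex.ofReal_re]

theorem setCoeff_zero (S : Set (UnitAddTorus ι)) :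
    setCoeff S 0 = (((torusMeasure ι).real S : ℝ) : ℂ) := by
  simp [setCoeff, UnitAddTorus.mFourier_zero]

theorem measurePreserving_neg_haarAddCircle :
    MeasurePreserving (fun z : UnitAddCircle => -z) AddCircle.haarAddCircle
      AddCircle.haarAddCircle :=
  Measure.measurePreserving_neg _

/-- Negating the coordinate `i`. -/
def flip {κ G : Type*} [Neg G] [DecidableEq κ] (i : κ) (k : κ → G) : κ → G :=
  fun j => if j = i then -k j else k j

theorem measurePreserving_flip [DecidableEq ι] (i : ι) :
    MeasurePreserving (flip i) (torusMeasure ι) (torusMeasure ι) := by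
  have := measurePreserving_pi (fun _ : ι => (AddCircle.haarAddCircle : Measure UnitAddCircle))
    (fun _ : ι => AddCircle.haarAddCircle)
    (f := fun j z => if j = i then -z else z) (fun j => by
      by_cases h : j = i
      · simpa [h] using measurePreserving_neg_haarAddCircle
      · simpa [h] using! MeasurePreserving.id AddCircle.haarAddCircle)
  exact this

theorem flip_flip {κ G : Type*} [InvolutiveNeg G] [DecidableEq κ] (i : κ) (k : κ → G) :
    flip i (flip i k) = k := by
  funext j; by_cases h : j = i <;> simp [flip, h]

theorem mFourier_flip [DecidableEq ι] (i : ι) (k : ι → ℤ) (z : UnitAddTorus ι) :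
    UnitAddTorus.mFourier (flip i k) (flip i z) = UnitAddTorus.mFourier k z := by
  simp only [UnitAddTorus.mFourier, ContinuousMap.coe_mk]
  refine Finset.prod_congr rfl fun j _ => ?_
  by_cases h : j = i <;> simp [flip, h, fourier_apply]

theorem setCoeff_flip [DecidableEq ι] {S : Set (UnitAddTorus ι)}
    (i : ι) (hi : ∀ z, flip i z ∈ S ↔ z ∈ S) (k : ι → ℤ) :
    setCoeff S (flip i k) = setCoeff S k := by
  have hpre : flip i ⁻¹' S = S := Set.ext hi
  have hm := measurePreserving_flip (ι := ι) i
  have hneg : -flip i k = flip i (-k) := by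
    funext j; by_cases h : j = i <;> simp [flip, h]
  have hemb : MeasurableEmbedding (flip (G := UnitAddCircle) i) :=
    (MeasurableEquiv.mk ⟨flip i, flip i, flip_flip i, flip_flip i⟩
      hm.measurable hm.measurable).measurableEmbedding
  rw [setCoeff, ← hm.setIntegral_preimage_emb hemb, hpre, hneg]
  simp only [mFourier_flip, setCoeff]

/-- A diagonal shift by `a` multiplies the coefficient by a character of `a` with frequency `-∑ i, k
i`, which is nontrivial when the sum is nonzero. -/
theorem setCoeff_eq_zero {S : Set (UnitAddTorus ι)}
    (hshift : ∀ (a : UnitAddCircle) z, (fun i => z i + a) ∈ S ↔ z ∈ S) {k : ι → ℤ}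
    (hk : ∑ i, k i ≠ 0) : setCoeff S k = 0 := by
  have key (a : UnitAddCircle) : setCoeff S k = fourier (-∑ i, k i) a * setCoeff S k := by
    have hm := measurePreserving_add_right (torusMeasure ι) (fun _ : ι => a)
    have hpre : (fun z : UnitAddTorus ι => z + fun _ => a) ⁻¹' S = S := Set.ext (hshift a)
    conv_lhs => rw [setCoeff, ← hm.setIntegral_preimage_emb
      (measurableEmbedding_addRight (fun _ : ι => a)), hpre]
    rw [setCoeff, ← integral_const_mul]
    congr 1
    funext z
    simp only [UnitAddTorus.mFourier, ContinuousMap.coe_mk, Pi.neg_apply, Pi.add_apply,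
      fourier_apply, smul_add, AddCircle.toCircle_add, Circle.coe_mul, Finset.prod_mul_distrib]
    rw [mul_comm]
    congr 1
    have : ∀ s : Finset ι, ∏ i ∈ s, ((AddCircle.toCircle (-k i • a) : Circle) : ℂ)
        = ((AddCircle.toCircle ((-∑ i ∈ s, k i) • a) : Circle) : ℂ) := by
      intro s
      classical
      induction s using Finset.induction_on with
      | empty => simp
      | insert i s his ih =>
        rw [Finset.prod_insert his, ih, Finset.sum_insert his, neg_add, add_smul,
          AddCircle.toCircle_add, Circle.coe_mul]
    exact this _
  -- At `a = 1 / (2 ∑ i, k i)` the character equals `-1`, so the coefficient is its own negative.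
  have h := key (((1 : ℝ) / 2 / ((∑ i, k i : ℤ) : ℝ) : ℝ) : UnitAddCircle)
  have hk' : ((∑ i, k i : ℤ) : ℂ) ≠ 0 := by exact_mod_cast hk
  have hval : fourier (-∑ i, k i) (((1 : ℝ) / 2 / ((∑ i, k i : ℤ) : ℝ) : ℝ) : UnitAddCircle)
      = -1 := by
    rw [fourier_coe_apply]
    rw [show (2 * (Real.pi : ℂ) * Complex.I * ((-∑ i, k i : ℤ) : ℂ) *
      (((1 : ℝ) / 2 / ((∑ i, k i : ℤ) : ℝ) : ℝ) : ℂ) / ((1 : ℝ) : ℂ)) = -(Real.pi * Complex.I) by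
        push_cast at hk' ⊢
        field_simp]
    rw [Complex.exp_neg, Complex.exp_pi_mul_I]; norm_num
  rw [hval] at h
  linear_combination h / 2

open Classical in
/-- Negating one nonzero coordinate, chosen in terms of the support only, if there is one. -/
def flipSupport (k : ι → ℤ) : ι → ℤ :=
  if h : ∃ i, k i ≠ 0 then flip h.choose k else k

theorem exists_flipSupport_eq {k : ι → ℤ} (hk : k ≠ 0) :
    ∃ i, k i ≠ 0 ∧ flipSupport k = open Classical in flip i k := by
  have h : ∃ i, k i ≠ 0 := Function.ne_iff.mp hk
  exact ⟨h.choose, h.choose_spec, by rw [flipSupport, dif_pos h]⟩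

/-- Negation preserves the support, so the second application chooses the same coordinate. Being an
involution, `flipSupport` can reindex sums. -/
theorem flipSupport_flipSupport (k : ι → ℤ) : flipSupport (flipSupport k) = k := by
  classical
  by_cases h : ∃ i, k i ≠ 0
  · have hsupp : (fun i => flip h.choose k i ≠ 0) = fun i => k i ≠ 0 := by
      funext i; by_cases hi : i = h.choose <;> simp [flip, hi]
    have h1 : flipSupport k = flip h.choose k := dif_pos h
    have h' : ∃ i, flip h.choose k i ≠ 0 := by
      have := congrArg (fun P : ι → Prop => ∃ i, P i) hsupp
      exact this.mpr h
    have hc : h'.choose = h.choose := by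
      simp only [Exists.choose, hsupp]
    rw [h1, flipSupport, dif_pos h', hc, flip_flip]
  · rw [flipSupport, dif_neg]
    · rw [flipSupport, dif_neg h]
    · rwa [flipSupport, dif_neg h]

theorem sum_flip [DecidableEq ι] (i : ι) (k : ι → ℤ) :
    ∑ j, flip i k j = ∑ j, k j - 2 * k i := by
  have h : ∀ j, flip i k j = k j - if j = i then 2 * k i else 0 := by
    intro j
    by_cases hj : j = i
    · subst hj; simp only [flip, if_true]; ring
    · simp [flip, hj]
  simp only [h, Finset.sum_sub_distrib, Finset.sum_ite_eq', Finset.mem_univ, if_true]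

open Classical in
/-- The squared modulus of a Fourier coefficient at the nonzero frequencies of zero sum. -/
def balancedWeight (A : Set (UnitAddTorus ι)) (k : ι → ℤ) : ℝ :=
  if k ≠ 0 ∧ ∑ i, k i = 0 then ‖setCoeff A k‖ ^ 2 else 0

theorem balancedWeight_nonneg (A : Set (UnitAddTorus ι)) (k : ι → ℤ) :
    0 ≤ balancedWeight A k := by
  unfold balancedWeight; split_ifs <;> positivity

theorem balancedWeight_le (A : Set (UnitAddTorus ι)) (k : ι → ℤ) :
    balancedWeight A k ≤ ‖setCoeff A k‖ ^ 2 := by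
  unfold balancedWeight; split_ifs
  · exact le_rfl
  · positivity

theorem balancedWeight_zero (A : Set (UnitAddTorus ι)) : balancedWeight A 0 = 0 := by
  simp [balancedWeight]

theorem summable_balancedWeight {A : Set (UnitAddTorus ι)} (hA : MeasurableSet A) :
    Summable (balancedWeight A) :=
  Summable.of_nonneg_of_le (balancedWeight_nonneg A) (balancedWeight_le A)
    (hasSum_sq_setCoeff hA).summable

/-- At most one of the two terms is nonzero: flipping coordinate `i` changes the sum of the
frequency by `2 * k i ≠ 0`. -/
theorem balancedWeight_add_le {A : Set (UnitAddTorus ι)}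
    (hflip : ∀ [DecidableEq ι] (i : ι) z, flip i z ∈ A ↔ z ∈ A) {k : ι → ℤ} (hk : k ≠ 0) :
    balancedWeight A k + balancedWeight A (flipSupport k) ≤ ‖setCoeff A k‖ ^ 2 := by
  classical
  obtain ⟨i, hki, hfk⟩ := exists_flipSupport_eq hk
  by_cases h1 : ∑ j, k j = 0
  · have h2 : ∑ j, flipSupport k j ≠ 0 := by
      rw [hfk, sum_flip, h1]; omega
    have h3 : balancedWeight A (flipSupport k) = 0 := if_neg fun h => h2 h.2
    rw [h3, add_zero]
    exact balancedWeight_le A k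
  · have h3 : balancedWeight A k = 0 := if_neg fun h => h1 h.2
    rw [h3, zero_add]
    refine (balancedWeight_le A _).trans_eq ?_
    rw [hfk, setCoeff_flip i (hflip i)]

theorem flipSupport_zero : flipSupport (0 : ι → ℤ) = 0 := by
  rw [flipSupport, dif_neg]
  simp

theorem hasSum_balancedWeight_flipSupport {A : Set (UnitAddTorus ι)} (hA : MeasurableSet A) :
    HasSum (fun k => balancedWeight A (flipSupport k)) (∑' k, balancedWeight A k) := by
  have h := (Equiv.hasSum_iff (f := balancedWeight A)
    (Function.Involutive.toPerm (flipSupport (ι := ι)) flipSupport_flipSupport)).mpr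
    (summable_balancedWeight hA).hasSum
  exact h

theorem two_mul_tsum_balancedWeight_le {A : Set (UnitAddTorus ι)} (hA : MeasurableSet A)
    (hflip : ∀ [DecidableEq ι] (i : ι) z, flip i z ∈ A ↔ z ∈ A) :
    2 * ∑' k, balancedWeight A k ≤
      (torusMeasure ι).real A - (torusMeasure ι).real A ^ 2 := by
  classical
  rw [two_mul]
  refine hasSum_le (fun k => ?_) ((summable_balancedWeight hA).hasSum.add
    (hasSum_balancedWeight_flipSupport hA))
    ((hasSum_sq_setCoeff hA).sub (hasSum_ite_eq (0 : ι → ℤ) ((torusMeasure ι).real A ^ 2)))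
  by_cases hk : k = 0
  · subst hk
    rw [flipSupport_zero, balancedWeight_zero, setCoeff_zero, if_pos rfl, Complex.norm_real,
      Real.norm_eq_abs, sq_abs]
    simp
  · rw [if_neg hk, sub_zero]
    exact balancedWeight_add_le hflip hk

/-- Young's inequality with a free weight `t`, a form of Cauchy–Schwarz that can be summed term by
term. -/
theorem re_setCoeff_mul_le {D A : Set (UnitAddTorus ι)}
    (hshift : ∀ (a : UnitAddCircle) z, (fun i => z i + a) ∈ D ↔ z ∈ D) {k : ι → ℤ} (hk : k ≠ 0)
    {t : ℝ} (ht : 0 < t) :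
    (conj (setCoeff D k) * setCoeff A k).re ≤
      t / 2 * ‖setCoeff D k‖ ^ 2 + 1 / (2 * t) * balancedWeight A k := by
  by_cases h1 : ∑ j, k j = 0
  · have hre : (conj (setCoeff D k) * setCoeff A k).re ≤ ‖setCoeff D k‖ * ‖setCoeff A k‖ :=
      (Complex.re_le_norm _).trans_eq (by simp)
    have hw : balancedWeight A k = ‖setCoeff A k‖ ^ 2 := if_pos ⟨hk, h1⟩
    rw [hw]
    have h3 : t / 2 * ‖setCoeff D k‖ ^ 2 + 1 / (2 * t) * ‖setCoeff A k‖ ^ 2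
        - ‖setCoeff D k‖ * ‖setCoeff A k‖
        = (t * ‖setCoeff D k‖ - ‖setCoeff A k‖) ^ 2 / (2 * t) := by
      field_simp; ring
    have h4 : 0 ≤ (t * ‖setCoeff D k‖ - ‖setCoeff A k‖) ^ 2 / (2 * t) := by positivity
    linarith
  · rw [setCoeff_eq_zero hshift h1]
    have := balancedWeight_nonneg A k
    simp only [map_zero, zero_mul, Complex.zero_re, norm_zero]
    positivity

theorem measureReal_sub_mul_le {D A : Set (UnitAddTorus ι)} (hD : MeasurableSet D)
    (hA : MeasurableSet A) (hDA : D ⊆ A)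
    (hshift : ∀ (a : UnitAddCircle) z, (fun i => z i + a) ∈ D ↔ z ∈ D) {t : ℝ} (ht : 0 < t) :
    (torusMeasure ι).real D - (torusMeasure ι).real D * (torusMeasure ι).real A ≤
      t / 2 * ((torusMeasure ι).real D - (torusMeasure ι).real D ^ 2) +
        1 / (2 * t) * ∑' k, balancedWeight A k := by
  classical
  have hDA' := Complex.hasSum_re (hasSum_setCoeff_mul hD hA)
  rw [Set.inter_eq_left.mpr hDA, Complex.ofReal_re] at hDA'
  refine hasSum_le (fun k => ?_) (hDA'.sub (hasSum_ite_eq (0 : ι → ℤ) _))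
    ((((hasSum_sq_setCoeff hD).sub (hasSum_ite_eq (0 : ι → ℤ) _)).mul_left (t / 2)).add
      ((summable_balancedWeight hA).hasSum.mul_left (1 / (2 * t))))
  by_cases hk : k = 0
  · subst hk
    rw [balancedWeight_zero, setCoeff_zero, setCoeff_zero, if_pos rfl, if_pos rfl,
      Complex.norm_real, Real.norm_eq_abs, sq_abs, Complex.conj_ofReal, ← Complex.ofReal_mul,
      Complex.ofReal_re]
    simp
  · rw [if_neg hk, if_neg hk, sub_zero, sub_zero]
    exact re_setCoeff_mul_le hshift hk ht

/-- A shift-invariant set contained in a set that is invariant under sign changes is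
substantially smaller: the odds at least double. -/
theorem two_mul_measureReal_le {D A : Set (UnitAddTorus ι)} (hD : MeasurableSet D)
    (hA : MeasurableSet A) (hDA : D ⊆ A)
    (hshift : ∀ (a : UnitAddCircle) z, (fun i => z i + a) ∈ D ↔ z ∈ D)
    (hflip : ∀ [DecidableEq ι] (i : ι) z, flip i z ∈ A ↔ z ∈ A) :
    2 * (torusMeasure ι).real D * (1 - (torusMeasure ι).real A) ≤
      (torusMeasure ι).real A * (1 - (torusMeasure ι).real D) := by
  have hqp : (torusMeasure ι).real D ≤ (torusMeasure ι).real A := measureReal_mono hDA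
  have hp1 : (torusMeasure ι).real A ≤ 1 := measureReal_le_one
  have hp0 : 0 ≤ (torusMeasure ι).real A := measureReal_nonneg
  have main {t : ℝ} := measureReal_sub_mul_le hD hA hDA hshift (t := t)
  have hw := two_mul_tsum_balancedWeight_le hA hflip
  generalize (torusMeasure ι).real D = q at *
  generalize (torusMeasure ι).real A = p at *
  rcases hp1.eq_or_lt with h1 | h1
  · rw [h1, sub_self, mul_zero, one_mul]
    linarith
  · have hp' : 0 < 1 - p := by linarith
    have hq' : 0 < 1 - q := by linarith
    -- This `t` is the optimal weight in the equality case `2 q (1 - p) = p (1 - q)`, and avoids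
    -- square roots.
    have hm := main (t := (1 - p) / (1 - q)) (by positivity)
    have e1 : (1 - p) / (1 - q) / 2 * (q - q ^ 2) = q * (1 - p) / 2 := by
      field_simp
    have e2 : 1 / (2 * ((1 - p) / (1 - q))) * ((p - p ^ 2) / 2) = p * (1 - q) / 4 := by
      field_simp; ring
    have e3 : 1 / (2 * ((1 - p) / (1 - q))) * ∑' k, balancedWeight A k ≤
        1 / (2 * ((1 - p) / (1 - q))) * ((p - p ^ 2) / 2) :=
      mul_le_mul_of_nonneg_left (by linarith) (by positivity)
    rw [e1] at hm
    rw [e2] at e3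
    linarith

end Fourier

/-! ### Monotonicity and measurability of graph events -/

section Graph

theorem geomGraph_le {M N : Type*} [MetricSpace M] [MetricSpace N] {n : ℕ} {x : Fin n → M}
    {y : Fin n → N} {r s : ℝ} (h : ∀ i j, dist (x i) (x j) ≤ r → dist (y i) (y j) ≤ s) :
    geomGraph x r ≤ geomGraph y s := fun i j hij => ⟨hij.1, h i j hij.2⟩

theorem measurableSet_geomGraph_mem {Ω M : Type*} [MeasurableSpace Ω] [MetricSpace M] {n : ℕ}
    {x : Ω → Fin n → M} (hx : ∀ i j, Measurable fun ω => dist (x ω i) (x ω j))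
    (F : Set (SimpleGraph (Fin n))) (r : ℝ) : MeasurableSet {ω | geomGraph (x ω) r ∈ F} := by
  have h1 (G : SimpleGraph (Fin n)) : MeasurableSet {ω | geomGraph (x ω) r = G} := by
    have : {ω | geomGraph (x ω) r = G} =
        ⋂ i, ⋂ j, {ω | (i ≠ j ∧ dist (x ω i) (x ω j) ≤ r) ↔ G.Adj i j} := by
      ext ω
      simp only [Set.mem_ofPred_eq, Set.mem_iInter, SimpleGraph.ext_iff, funext_iff, eq_iff_iff]
      rfl
    rw [this]
    refine MeasurableSet.iInter fun i => MeasurableSet.iInter fun j => ?_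
    have hd : MeasurableSet {ω | dist (x ω i) (x ω j) ≤ r} :=
      measurableSet_le (hx i j) measurable_const
    exact MeasurableSet.iff ((MeasurableSet.const (i ≠ j)).inter hd) (.const _)
  have h2 : {ω | geomGraph (x ω) r ∈ F} = ⋃ G ∈ F, {ω | geomGraph (x ω) r = G} := by
    ext ω; simp
  rw [h2]
  exact MeasurableSet.biUnion (Set.to_countable F) fun G _ => h1 G

end Graph

/-! ### Measure-preserving Lipschitz maps between cube and torus -/

section Transport

theorem volume_unitAddCircle :
    (volume : Measure UnitAddCircle) = AddCircle.haarAddCircle := by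
  rw [AddCircle.volume_eq_smul_haarAddCircle]; simp

theorem measurePreserving_coe_unitAddCircle :
    MeasurePreserving ((↑) : ℝ → UnitAddCircle) (volume.restrict (Set.Icc 0 1))
      AddCircle.haarAddCircle := by
  have h := UnitAddCircle.measurePreserving_mk 0
  rw [zero_add, volume_unitAddCircle] at h
  rwa [← restrict_Ioc_eq_restrict_Icc]

theorem measurePreserving_two_mul_norm :
    MeasurePreserving (fun z : UnitAddCircle => 2 * ‖z‖) AddCircle.haarAddCircle
      (volume.restrict (Set.Icc 0 1)) := by
  have hm : Measurable fun z : UnitAddCircle => 2 * ‖z‖ := by fun_prop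
  refine ⟨hm, ?_⟩
  have : IsProbabilityMeasure (Measure.map (fun z : UnitAddCircle => 2 * ‖z‖)
    AddCircle.haarAddCircle) := Measure.isProbabilityMeasure_map hm.aemeasurable
  refine Measure.ext_of_Iic _ _ fun t => ?_
  rw [Measure.map_apply hm measurableSet_Iic, Measure.restrict_apply measurableSet_Iic]
  -- Distribution functions are compared: a ball of radius `t / 2` in the circle has measure `min 1
  -- t`.
  have h1 : (fun z : UnitAddCircle => 2 * ‖z‖) ⁻¹' Set.Iic t = Metric.closedBall 0 (t / 2) := by
    ext z
    simp only [Set.mem_preimage, Set.mem_Iic, mem_closedBall_zero_iff]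
    constructor <;> intro h <;> linarith
  have h2 : Set.Iic t ∩ Set.Icc 0 1 = Set.Icc 0 (min 1 t) := by
    ext z
    simp only [Set.mem_inter_iff, Set.mem_Iic, Set.mem_Icc, le_min_iff]
    tauto
  rw [h1, h2, ← volume_unitAddCircle, AddCircle.volume_closedBall, Real.volume_Icc, sub_zero,
    mul_div_cancel₀ _ two_ne_zero]

theorem measurePreserving_uncurry {α β : Type*} [Fintype α] [Fintype β] :
    MeasurePreserving (MeasurableEquiv.curry α β UnitAddCircle).symm
      (Measure.pi fun _ : α => torusMeasure β) (torusMeasure (α × β)) := by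
  refine ⟨(MeasurableEquiv.curry α β UnitAddCircle).symm.measurable, ?_⟩
  refine (Measure.pi_eq fun s hs => ?_).symm
  rw [Measure.map_apply (MeasurableEquiv.measurable _) (MeasurableSet.univ_pi hs)]
  have : (MeasurableEquiv.curry α β UnitAddCircle).symm ⁻¹' Set.univ.pi s =
      Set.univ.pi fun a => Set.univ.pi fun b => s (a, b) := by
    ext z
    simp [Set.mem_pi, MeasurableEquiv.curry, Function.uncurry]
  rw [this, Measure.pi_pi]
  simp only [torusMeasure, Measure.pi_pi]
  rw [Fintype.prod_prod_type]

variable {d n : ℕ}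

theorem measurePreserving_ofLp_cube :
    MeasurePreserving (fun x : cube d => (x : EuclideanSpace ℝ (Fin d)).ofLp) (cubeMeasure d)
      (Measure.pi fun _ => volume.restrict (Set.Icc 0 1)) := by
  have h1 : MeasurePreserving (Subtype.val : cube d → _) (cubeMeasure d)
      (volume.restrict (cube d)) :=
    ⟨measurable_subtype_coe, map_comap_subtype_coe (measurableSet_cube d) _⟩
  have h2 := (PiLp.volume_preserving_ofLp (Fin d)).restrict_preimage
    (MeasurableSet.univ_pi fun _ => measurableSet_Icc (a := (0 : ℝ)) (b := 1))
  have h3 : (WithLp.ofLp : EuclideanSpace ℝ (Fin d) → Fin d → ℝ) ⁻¹'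
      (Set.univ.pi fun _ => Set.Icc (0 : ℝ) 1) = cube d := by
    ext x; simp [cube, Set.mem_pi, -Set.pi_univ_Icc]
  rw [h3, volume_pi, Measure.restrict_pi_pi] at h2
  exact h2.comp h1

/-- A point of the torus seen as a configuration of `n` points in the `d`-dimensional torus with
its Euclidean metric. -/
def torusConfig (z : UnitAddTorus (Fin n × Fin d)) (i : Fin n) :
    PiLp 2 fun _ : Fin d => UnitAddCircle :=
  WithLp.toLp 2 fun j => z (i, j)

/-- The torus is folded onto the cube by `z ↦ 2 * ‖z‖` in each coordinate. -/
def foldPoint (z : UnitAddTorus (Fin d)) : cube d :=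
  ⟨WithLp.toLp 2 fun j => 2 * ‖z j‖, fun j => ⟨by positivity, by
    have := AddCircle.norm_le_half_period 1 (x := z j) one_ne_zero
    rw [abs_one] at this
    change 2 * ‖z j‖ ≤ 1
    linarith⟩⟩

/-- Folding each of `n` points. -/
def foldConfig (z : UnitAddTorus (Fin n × Fin d)) (i : Fin n) : cube d :=
  foldPoint fun j => z (i, j)

/-- The image in the torus of a configuration in the cube. -/
def wrapConfig (x : Fin n → cube d) : UnitAddTorus (Fin n × Fin d) :=
  fun ij => (((x ij.1 : EuclideanSpace ℝ (Fin d)) ij.2 : ℝ) : UnitAddCircle)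

theorem measurePreserving_foldPoint :
    MeasurePreserving (foldPoint (d := d)) (torusMeasure (Fin d)) (cubeMeasure d) := by
  have h1 := measurePreserving_pi (fun _ : Fin d => AddCircle.haarAddCircle)
    (fun _ : Fin d => volume.restrict (Set.Icc (0 : ℝ) 1))
    fun _ => measurePreserving_two_mul_norm
  have hemb : MeasurableEmbedding (fun x : cube d => (x : EuclideanSpace ℝ (Fin d)).ofLp) :=
    (MeasurableEquiv.toLp 2 (Fin d → ℝ)).symm.measurableEmbedding.comp
      (MeasurableEmbedding.subtype_coe (measurableSet_cube d))
  have hm : Measurable (foldPoint (d := d)) := by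
    refine hemb.measurable_comp_iff.mp ?_
    exact h1.measurable
  refine ⟨hm, ?_⟩
  -- Both measures are recovered from their images in `Fin d → ℝ`, where the product structure is
  -- available.
  rw [← hemb.comap_map (Measure.map _ _), ← hemb.comap_map (cubeMeasure d),
    Measure.map_map hemb.measurable hm, measurePreserving_ofLp_cube.map_eq]
  exact congrArg _ h1.map_eq

theorem measurePreserving_foldConfig :
    MeasurePreserving (foldConfig (n := n) (d := d)) (torusMeasure (Fin n × Fin d))
      (Measure.pi fun _ => cubeMeasure d) := by
  have h1 := measurePreserving_pi (fun _ : Fin n => torusMeasure (Fin d))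
    (fun _ : Fin n => cubeMeasure d) fun _ => measurePreserving_foldPoint
  exact h1.comp (MeasurePreserving.symm _ measurePreserving_uncurry)

theorem measurePreserving_wrapConfig :
    MeasurePreserving (wrapConfig (n := n) (d := d)) (Measure.pi fun _ => cubeMeasure d)
      (torusMeasure (Fin n × Fin d)) := by
  have h1 := (measurePreserving_pi (fun _ : Fin d => volume.restrict (Set.Icc (0 : ℝ) 1))
    (fun _ : Fin d => AddCircle.haarAddCircle)
    fun _ => measurePreserving_coe_unitAddCircle).comp measurePreserving_ofLp_cube
  have h2 := measurePreserving_pi (fun _ : Fin n => cubeMeasure d)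
    (fun _ : Fin n => torusMeasure (Fin d)) fun _ => h1
  exact measurePreserving_uncurry.comp h2

theorem dist_torusConfig_wrapConfig_le (x : Fin n → cube d) (i j : Fin n) :
    dist (torusConfig (wrapConfig x) i) (torusConfig (wrapConfig x) j) ≤ dist (x i) (x j) := by
  rw [Subtype.dist_eq, EuclideanSpace.dist_eq, PiLp.dist_eq_of_L2]
  refine Real.sqrt_le_sqrt (Finset.sum_le_sum fun k _ => ?_)
  refine pow_le_pow_left₀ dist_nonneg ?_ 2
  simp only [torusConfig, wrapConfig, dist_eq_norm, ← AddCircle.coe_sub]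
  exact QuotientAddGroup.norm_mk_le_norm

theorem dist_foldConfig_le (z : UnitAddTorus (Fin n × Fin d)) (i j : Fin n) :
    dist (foldConfig z i) (foldConfig z j) ≤ 2 * dist (torusConfig z i) (torusConfig z j) := by
  rw [Subtype.dist_eq, EuclideanSpace.dist_eq, PiLp.dist_eq_of_L2 (torusConfig z i)]
  rw [← Real.sqrt_sq (zero_le_two (α := ℝ)), ← Real.sqrt_mul (sq_nonneg _), Finset.mul_sum]
  refine Real.sqrt_le_sqrt (Finset.sum_le_sum fun k _ => ?_)
  rw [← mul_pow]
  refine pow_le_pow_left₀ dist_nonneg ?_ 2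
  simp only [torusConfig, foldConfig, foldPoint, dist_eq_norm, ← mul_sub, norm_mul,
    Real.norm_ofNat]
  exact mul_le_mul_of_nonneg_left (abs_norm_sub_norm_le _ _) zero_le_two

end Transport

/-! ### Growth of the odds under doubling of the radius -/

section Doubling

variable {d n : ℕ}

theorem measurable_dist_eval (i j : Fin n) :
    Measurable fun x : Fin n → cube d => dist (x i) (x j) := by fun_prop

theorem prob_mono {M : Type*} [MetricSpace M] [MeasurableSpace M] (μ : Measure M)
    [IsProbabilityMeasure μ] {F : Set (SimpleGraph (Fin n))} (hF : IsNontrivialMonotone F) {r s : ℝ}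
    (hrs : r ≤ s) : prob μ F r ≤ prob μ F s :=
  measureReal_mono fun _ hx => hF.monotone _ hx _ (geomGraph_le fun _ _ h => h.trans hrs)

/-- Doubling the radius at least doubles the odds of a monotone property. -/
theorem two_mul_prob_le {F : Set (SimpleGraph (Fin n))} (hF : IsNontrivialMonotone F) (r : ℝ) :
    2 * prob (cubeMeasure d) F r * (1 - prob (cubeMeasure d) F (2 * r)) ≤
      prob (cubeMeasure d) F (2 * r) * (1 - prob (cubeMeasure d) F r) := by
  let D : Set (UnitAddTorus (Fin n × Fin d)) := {z | geomGraph (torusConfig z) r ∈ F}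
  let B : Set (Fin n → cube d) := {x | geomGraph x (2 * r) ∈ F}
  let A : Set (UnitAddTorus (Fin n × Fin d)) := foldConfig ⁻¹' B
  have hD : MeasurableSet D := by
    refine measurableSet_geomGraph_mem (fun i j => ?_) F r
    simp only [PiLp.dist_eq_of_L2, torusConfig]
    fun_prop
  have hB : MeasurableSet B := measurableSet_geomGraph_mem measurable_dist_eval F (2 * r)
  have hA : MeasurableSet A := measurePreserving_foldConfig.measurable hB
  have hDA : D ⊆ A := fun z hz => hF.monotone _ hz _ <| geomGraph_le fun i j h =>
    (dist_foldConfig_le z i j).trans (mul_le_mul_of_nonneg_left h zero_le_two)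
  have hshift (a : UnitAddCircle) (z) : (fun i => z i + a) ∈ D ↔ z ∈ D := by
    have : geomGraph (torusConfig fun i => z i + a) r = geomGraph (torusConfig z) r := by
      ext i j
      simp only [geomGraph, PiLp.dist_eq_of_L2, torusConfig, dist_add_right]
    change _ ∈ F ↔ _ ∈ F
    rw [this]
  have hflip [DecidableEq (Fin n × Fin d)] (i : Fin n × Fin d) (z) : flip i z ∈ A ↔ z ∈ A := by
    have : foldConfig (flip i z) = foldConfig z := by
      funext l
      refine Subtype.ext (PiLp.ext fun k => ?_)
      change 2 * ‖flip i z (l, k)‖ = 2 * ‖z (l, k)‖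
      by_cases h : (l, k) = i <;> simp [flip, h]
    change foldConfig _ ∈ B ↔ foldConfig _ ∈ B
    rw [this]
  have key := two_mul_measureReal_le hD hA hDA hshift hflip
  have hpA : (torusMeasure (Fin n × Fin d)).real A = prob (cubeMeasure d) F (2 * r) :=
    measurePreserving_foldConfig.measureReal_preimage hB.nullMeasurableSet
  have hpD : prob (cubeMeasure d) F r ≤ (torusMeasure (Fin n × Fin d)).real D := by
    rw [← measurePreserving_wrapConfig.measureReal_preimage hD.nullMeasurableSet]
    exact measureReal_mono fun x hx => hF.monotone _ hx _ <| geomGraph_le fun i j h =>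
      (dist_torusConfig_wrapConfig_le x i j).trans h
  rw [hpA] at key
  have h1 : prob (cubeMeasure d) F (2 * r) ≤ 1 := measureReal_le_one
  have h0 : 0 ≤ prob (cubeMeasure d) F (2 * r) := measureReal_nonneg
  calc _ ≤ 2 * (torusMeasure (Fin n × Fin d)).real D * (1 - prob (cubeMeasure d) F (2 * r)) := by
        gcongr
    _ ≤ _ := key
    _ ≤ _ := by gcongr

theorem two_pow_mul_prob_le {F : Set (SimpleGraph (Fin n))} (hF : IsNontrivialMonotone F) {r : ℝ}
    (hr : 0 ≤ r) (k : ℕ) :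
    2 ^ k * prob (cubeMeasure d) F r * (1 - prob (cubeMeasure d) F (2 ^ k * r)) ≤
      prob (cubeMeasure d) F (2 ^ k * r) * (1 - prob (cubeMeasure d) F r) := by
  induction k with
  | zero => simp
  | succ k ih =>
    have h := two_mul_prob_le (d := d) hF (2 ^ k * r)
    rw [← mul_assoc, ← pow_succ'] at h
    have hmono : prob (cubeMeasure d) F r ≤ prob (cubeMeasure d) F (2 ^ k * r) :=
      prob_mono _ hF (le_mul_of_one_le_left hr (one_le_pow₀ one_le_two))
    have h0 : 0 ≤ prob (cubeMeasure d) F r := measureReal_nonneg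
    have h0' : 0 ≤ prob (cubeMeasure d) F (2 ^ (k + 1) * r) := measureReal_nonneg
    generalize prob (cubeMeasure d) F (2 ^ (k + 1) * r) = c at *
    generalize prob (cubeMeasure d) F (2 ^ k * r) = b at *
    generalize prob (cubeMeasure d) F r = a at *
    -- Chaining the two odds inequalities cancels the middle probability `b`, so `b = 0` is treated
    -- apart.
    rcases (h0.trans hmono).eq_or_lt with hb | hb
    · have ha : a = 0 := le_antisymm (hb ▸ hmono) h0
      rw [ha]
      simpa using h0'
    · refine le_of_mul_le_mul_right ?_ hb
      have h1 : 2 ^ k * a * (2 * b * (1 - c)) ≤ 2 ^ k * a * (c * (1 - b)) :=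
        mul_le_mul_of_nonneg_left h (by positivity)
      have h2 : c * (2 ^ k * a * (1 - b)) ≤ c * (b * (1 - a)) :=
        mul_le_mul_of_nonneg_left ih h0'
      calc 2 ^ (k + 1) * a * (1 - c) * b = 2 ^ k * a * (2 * b * (1 - c)) := by ring
        _ ≤ 2 ^ k * a * (c * (1 - b)) := h1
        _ = c * (2 ^ k * a * (1 - b)) := by ring
        _ ≤ c * (b * (1 - a)) := h2
        _ = c * (1 - a) * b := by ring

theorem prob_le_of_prob_two_pow_mul_le {F : Set (SimpleGraph (Fin n))}
    (hF : IsNontrivialMonotone F) {r : ℝ} (hr : 0 ≤ r) {k : ℕ}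
    (h : prob (cubeMeasure d) F (2 ^ k * r) ≤ 1 / 2) :
    prob (cubeMeasure d) F r ≤ (1 / 2) ^ k := by
  have key := two_pow_mul_prob_le (d := d) hF hr k
  have h0 : 0 ≤ prob (cubeMeasure d) F r := measureReal_nonneg
  have h1 : prob (cubeMeasure d) F r ≤ 1 := measureReal_le_one
  have hk : (0 : ℝ) < 2 ^ k := by positivity
  have h2 : 2 ^ k * prob (cubeMeasure d) F r * (1 / 2) ≤
      2 ^ k * prob (cubeMeasure d) F r * (1 - prob (cubeMeasure d) F (2 ^ k * r)) :=
    mul_le_mul_of_nonneg_left (by linarith) (by positivity)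
  have h3 : prob (cubeMeasure d) F (2 ^ k * r) * (1 - prob (cubeMeasure d) F r) ≤
      1 / 2 * 1 := mul_le_mul h (by linarith) (by linarith) (by norm_num)
  rw [one_div, inv_pow, ← one_div, le_div_iff₀ hk]
  linarith

theorem one_sub_prob_two_pow_mul_le {F : Set (SimpleGraph (Fin n))}
    (hF : IsNontrivialMonotone F) {r : ℝ} (hr : 0 ≤ r) {k : ℕ}
    (h : 1 / 2 ≤ prob (cubeMeasure d) F r) :
    1 - prob (cubeMeasure d) F (2 ^ k * r) ≤ (1 / 2) ^ k := by
  have key := two_pow_mul_prob_le (d := d) hF hr k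
  have h1 : prob (cubeMeasure d) F (2 ^ k * r) ≤ 1 := measureReal_le_one
  have h1' : prob (cubeMeasure d) F r ≤ 1 := measureReal_le_one
  have hk : (0 : ℝ) < 2 ^ k := by positivity
  have h2 : 2 ^ k * (1 / 2) * (1 - prob (cubeMeasure d) F (2 ^ k * r)) ≤
      2 ^ k * prob (cubeMeasure d) F r * (1 - prob (cubeMeasure d) F (2 ^ k * r)) := by
    gcongr
  have h3 : prob (cubeMeasure d) F (2 ^ k * r) * (1 - prob (cubeMeasure d) F r) ≤
      1 * (1 / 2) := mul_le_mul h1 (by linarith) (by linarith) (by norm_num)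
  rw [one_div, inv_pow, ← one_div, le_div_iff₀ hk]
  linarith

end Doubling

/-! ### Small and large radii, and the crossing of one half -/

section Extremes

variable {d n : ℕ}

theorem IsNontrivialMonotone.top_mem {F : Set (SimpleGraph (Fin n))}
    (hF : IsNontrivialMonotone F) : ⊤ ∈ F := by
  obtain ⟨G, hG⟩ := Set.nonempty_iff_ne_empty.mpr hF.ne_empty
  exact hF.monotone G hG _ le_top

theorem IsNontrivialMonotone.bot_notMem {F : Set (SimpleGraph (Fin n))}
    (hF : IsNontrivialMonotone F) : ⊥ ∉ F := fun h =>
  hF.ne_univ (Set.eq_univ_of_forall fun G => hF.monotone _ h G bot_le)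

theorem nullSingletonClass_cubeMeasure (hd : 1 ≤ d) : NullSingletonClass (cubeMeasure d) where
  measure_singleton x := by
    have : Nonempty (Fin d) := ⟨⟨0, hd⟩⟩
    rw [cubeMeasure, comap_subtype_coe_apply (measurableSet_cube d), Set.image_singleton,
      measure_singleton]

theorem pi_measure_eq_eval_eq_zero {M : Type*} [MeasurableSpace M] [MeasurableEq M]
    (μ : Measure M) [IsProbabilityMeasure μ] [NullSingletonClass μ] {i j : Fin n} (hij : i ≠ j) :
    (Measure.pi fun _ : Fin n => μ) {x | x i = x j} = 0 := by
  have hind := ProbabilityTheory.iIndepFun_pi (μ := fun _ : Fin n => μ) (X := fun _ => id)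
    fun _ => aemeasurable_id
  have h2 := (ProbabilityTheory.indepFun_iff_map_prod_eq_prod_map_map
    (measurable_pi_apply i).aemeasurable (measurable_pi_apply j).aemeasurable).mp
    (hind.indepFun hij)
  have hi (l : Fin n) : Measure.map (fun x : Fin n → M => x l) (Measure.pi fun _ => μ) = μ :=
    (measurePreserving_eval (fun _ : Fin n => μ) l).map_eq
  rw [hi i, hi j] at h2
  have hdiag : MeasurableSet (Set.diagonal M) := measurableSet_diagonal
  have h3 : (Measure.pi fun _ : Fin n => μ) {x | x i = x j} = (μ.prod μ) (Set.diagonal M) := by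
    rw [← h2, Measure.map_apply (by fun_prop) hdiag]
    rfl
  rw [h3, Measure.measure_prod_null hdiag]
  refine Filter.Eventually.of_forall fun x => ?_
  have : Prod.mk x ⁻¹' Set.diagonal M = {x} := by
    ext y; simp [eq_comm]
  change μ (Prod.mk x ⁻¹' Set.diagonal M) = 0
  rw [this, measure_singleton]

/-- Sample points are almost surely distinct, so along radii `1 / (m + 1)` the graph eventually has
no edges; continuity from above turns this into a small probability. Absence of atoms needs `1 ≤ d`.
-/
theorem exists_prob_lt_half (hd : 1 ≤ d) {F : Set (SimpleGraph (Fin n))}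
    (hF : IsNontrivialMonotone F) : ∃ s > 0, prob (cubeMeasure d) F s < 1 / 2 := by
  have := nullSingletonClass_cubeMeasure hd
  let P : Measure (Fin n → cube d) := Measure.pi fun _ => cubeMeasure d
  let S : ℕ → Set (Fin n → cube d) := fun m => {x | geomGraph x (1 / ((m : ℝ) + 1)) ∈ F}
  have hS : Antitone S := fun a b hab x hx =>
    hF.monotone _ hx _ (geomGraph_le fun _ _ h => h.trans (Nat.one_div_le_one_div hab))
  have hlim := tendsto_measure_iInter_atTop (μ := P)
    (fun m => (measurableSet_geomGraph_mem measurable_dist_eval F _ :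
      MeasurableSet (S m)).nullMeasurableSet) hS ⟨0, measure_ne_top _ _⟩
  have hnull : P (⋂ m, S m) = 0 := by
    have hae : ∀ᵐ x ∂P, ∀ i j : Fin n, i ≠ j → x i ≠ x j := by
      rw [ae_all_iff]; intro i
      rw [ae_all_iff]; intro j
      by_cases hij : i = j
      · exact Eventually.of_forall fun x h => absurd hij h
      · have h0 := pi_measure_eq_eval_eq_zero (cubeMeasure d) hij
        have : ∀ᵐ x ∂P, ¬ x i = x j := measure_eq_zero_iff_ae_notMem.mp h0
        filter_upwards [this] with x hx _ using hx
    refine measure_eq_zero_iff_ae_notMem.mpr ?_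
    filter_upwards [hae] with x hx hmem
    have hev : ∀ᶠ m : ℕ in atTop, ∀ i j : Fin n, i ≠ j → 1 / ((m : ℝ) + 1) < dist (x i) (x j) := by
      refine eventually_all.mpr fun i => eventually_all.mpr fun j => ?_
      by_cases hij : i = j
      · exact Eventually.of_forall fun m h => absurd hij h
      · filter_upwards [tendsto_one_div_add_atTop_nhds_zero_nat.eventually_lt_const
          (dist_pos.mpr (hx i j hij))] with m hm _ using hm
    obtain ⟨m, hm⟩ := hev.exists
    have hbot : geomGraph x (1 / ((m : ℝ) + 1)) = ⊥ := by
      refine eq_bot_iff.mpr fun i j h => ?_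
      exact absurd h.2 (not_le.mpr (hm i j h.1))
    have hmF : geomGraph x (1 / ((m : ℝ) + 1)) ∈ F := Set.mem_iInter.mp hmem m
    rw [hbot] at hmF
    exact hF.bot_notMem hmF
  rw [hnull] at hlim
  obtain ⟨m, hm⟩ := (hlim.eventually_lt_const (show (0 : ENNReal) < ENNReal.ofReal (1 / 2) by
    simp)).exists
  refine ⟨1 / ((m : ℝ) + 1), by positivity, ?_⟩
  exact (ENNReal.lt_ofReal_iff_toReal_lt (measure_ne_top _ _)).mp hm

theorem prob_eq_one_of_sqrt_le {F : Set (SimpleGraph (Fin n))} (hF : IsNontrivialMonotone F)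
    {s : ℝ} (hs : √(d : ℝ) ≤ s) : prob (cubeMeasure d) F s = 1 := by
  have h : {x : Fin n → cube d | geomGraph x s ∈ F} = Set.univ := by
    refine Set.eq_univ_of_forall fun x => hF.monotone _ hF.top_mem _ fun i j hij => ⟨hij, ?_⟩
    refine le_trans ?_ hs
    rw [Subtype.dist_eq, EuclideanSpace.dist_eq]
    refine Real.sqrt_le_sqrt ?_
    calc _ ≤ ∑ _k : Fin d, (1 : ℝ) := Finset.sum_le_sum fun k _ => ?_
      _ = d := by simp
    refine pow_le_one₀ dist_nonneg ?_
    have h1 := (x i).2 k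
    have h2 := (x j).2 k
    rw [Real.dist_eq, abs_le]
    exact ⟨by linarith [h1.1, h2.2], by linarith [h1.2, h2.1]⟩
  rw [prob, h, probReal_univ]

/-- There is a radius at which the probability crosses one half upon doubling. -/
theorem exists_radius (hd : 1 ≤ d) {F : Set (SimpleGraph (Fin n))}
    (hF : IsNontrivialMonotone F) :
    ∃ r > 0, prob (cubeMeasure d) F r < 1 / 2 ∧ 1 / 2 ≤ prob (cubeMeasure d) F (2 * r) := by
  obtain ⟨s, hs, hlt⟩ := exists_prob_lt_half hd hF
  have hex : ∃ m : ℕ, 1 / 2 ≤ prob (cubeMeasure d) F (2 ^ m * s) := by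
    obtain ⟨m, hm⟩ := pow_unbounded_of_one_lt (√(d : ℝ) / s) (one_lt_two (α := ℝ))
    refine ⟨m, ?_⟩
    rw [prob_eq_one_of_sqrt_le hF ((div_le_iff₀ hs).mp hm.le)]
    norm_num
  classical
  have hspec := Nat.find_spec hex
  have hmin := fun {m} => Nat.find_min hex (m := m)
  -- The least exponent is not zero because the probability at `s` itself is below one half; its
  -- predecessor gives the radius.
  obtain ⟨m, hm⟩ : ∃ m, Nat.find hex = m + 1 := by
    refine Nat.exists_eq_succ_of_ne_zero fun h0 => ?_
    rw [h0, pow_zero, one_mul] at hspec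
    linarith
  refine ⟨2 ^ m * s, by positivity, not_le.mp (hmin (by omega)), ?_⟩
  rwa [hm, pow_succ', mul_assoc] at hspec

end Extremes

/-! ### Assembly of the threshold -/

theorem admitsThresholds_cube {d : ℕ} (hd : 1 ≤ d) :
    AdmitsThresholds (cube d) (cubeMeasure d) := by
  intro F hF
  have hex (n : ℕ) : ∃ r : ℝ, 0 < r ∧ (2 ≤ n → prob (cubeMeasure d) (F n) r < 1 / 2 ∧
      1 / 2 ≤ prob (cubeMeasure d) (F n) (2 * r)) := by
    by_cases hn : 2 ≤ n
    · obtain ⟨r, hr, h⟩ := exists_radius hd (hF n hn)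
      exact ⟨r, hr, fun _ => h⟩
    -- For `n < 2` any positive radius serves; the limits ignore these indices.
    · exact ⟨1, one_pos, fun h => absurd h hn⟩
  choose r hr hprob using hex
  have hpow : Tendsto (fun k : ℕ => ((1 : ℝ) / 2) ^ k) atTop (𝓝 0) :=
    tendsto_pow_atTop_nhds_zero_of_lt_one (by norm_num) (by norm_num)
  refine ⟨r, hr, fun s hs => ⟨fun hlim => ?_, fun hlim => ?_⟩⟩
  · refine tendsto_order.mpr ⟨fun a ha => Eventually.of_forall fun n =>
      ha.trans_le measureReal_nonneg, fun ε hε => ?_⟩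
    obtain ⟨k, hk⟩ := (hpow.eventually_lt_const hε).exists
    filter_upwards [eventually_ge_atTop 2,
      hlim.eventually_lt_const (show (0 : ℝ) < 1 / 2 ^ k by positivity)] with n hn hlt
    have hle : 2 ^ k * s n ≤ r n := by
      rw [div_lt_div_iff₀ (hr n) (by positivity)] at hlt
      linarith
    exact (prob_le_of_prob_two_pow_mul_le (hF n hn) (hs n)
      ((prob_mono _ (hF n hn) hle).trans (hprob n hn).1.le)).trans_lt hk
  · refine tendsto_order.mpr ⟨fun a ha => ?_, fun a ha => Eventually.of_forall fun n =>
      measureReal_le_one.trans_lt ha⟩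
    obtain ⟨k, hk⟩ := (hpow.eventually_lt_const (sub_pos.mpr ha)).exists
    -- The extra factor 2 appears because the probability is known to reach one half only at `2 * r
    -- n`.
    filter_upwards [eventually_ge_atTop 2, hlim.eventually_ge_atTop (2 ^ k * 2)] with n hn hge
    have hle : 2 ^ k * (2 * r n) ≤ s n := by
      rw [le_div_iff₀ (hr n)] at hge
      linarith
    have h1 := one_sub_prob_two_pow_mul_le (d := d) (hF n hn) (k := k)
      (by linarith [hr n] : 0 ≤ 2 * r n) (hprob n hn).2
    have h2 := prob_mono (cubeMeasure d) (hF n hn) hle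
    linarith

end RandomGeometricGraph

end

theorem mainTheorem4 (d : ℕ) (hd : 1 ≤ d) :
    RandomGeometricGraph.AdmitsThresholds (RandomGeometricGraph.cube d)
      (RandomGeometricGraph.cubeMeasure d) :=
  RandomGeometricGraph.admitsThresholds_cube hd
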